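/- Let $n\ge 0$, let $P\subset\mathbb{E}^n$ be a convex polyhedral set, i.e. a nonempty set which is an intersection of finitely many (possibly zero) closed halfspaces of $\mathbb{E}^n$ (the empty intersection being $\mathbb{E}^n$), and let $\mathbf p_0\in\mathbb{E}^n$. For $r\in\mathbb{R}$ put $V(r)=\mathrm{Vol}_n\left[P\cap B_n(\mathbf p_0,r)\right]$ if $r\ge 0$ and $V(r)=0$ if $r<0$, where $B_n(\mathbf p_0,r)$ is the closed ball of radius $r$ centered at $\mathbf p_0$ and $\mathrm{Vol}_n$ is $n$-dimensional Lebesgue measure. Then there are a real number $R>0$ and a holomorphic function $f$ on the punctured neighborhood $\{z\in\mathbb{C} : |z|>R\}$ of $\infty$ such that $f(r)=V(r)$ for all real $r>R$, and $f$ is meromorphic at $\infty$ with at most a pole of order not greater than $n$ there, i.e. $s\mapsto f(1/s)$ is meromorphic at $s=0$ of order at least $-n$. -/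

import Mathlib

open MeasureTheory

/-- A closed halfspace of `𝔼ⁿ`: the solution set of a nontrivial affine inequality `⟪a, x⟫ ≤ b`. -/
def IsClosedHalfspace {n : ℕ} (H : Set (EuclideanSpace ℝ (Fin n))) : Prop :=
  ∃ (a : EuclideanSpace ℝ (Fin n)) (b : ℝ), a ≠ 0 ∧ H = {x | inner ℝ a x ≤ b}

/-- A (convex) polyhedral set of `𝔼ⁿ`: a nonempty intersection of finitely many (maybe zero)
closed halfspaces; the intersection of the empty family is the whole space. -/
def IsPolyhedralSet {n : ℕ} (P : Set (EuclideanSpace ℝ (Fin n))) : Prop :=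
  P.Nonempty ∧ ∃ 𝓗 : Set (Set (EuclideanSpace ℝ (Fin n))),
    𝓗.Finite ∧ (∀ H ∈ 𝓗, IsClosedHalfspace H) ∧ P = ⋂₀ 𝓗

/-- The volume of `P` truncated by the ball of radius `r` centered at `p₀`, as a function of the
real variable `r`; it is zero for `r < 0`. -/
noncomputable def truncatedVolume {n : ℕ} (P : Set (EuclideanSpace ℝ (Fin n)))
    (p₀ : EuclideanSpace ℝ (Fin n)) (r : ℝ) : ℝ :=
  if r < 0 then 0 else (volume (P ∩ Metric.closedBall p₀ r)).toReal

/-- `f` is meromorphic at `∞` with a pole there of order at most `n` (possibly no pole at all):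
in the coordinate `s = 1 / z` the function is meromorphic at `s = 0`, of order at least `-n`. -/
def HasPoleAtInftyOfOrderLE (f : ℂ → ℂ) (n : ℕ) : Prop :=
  MeromorphicAt (fun s : ℂ => f s⁻¹) 0 ∧
    ((-(n : ℤ) : ℤ) : WithTop ℤ) ≤ meromorphicOrderAt (fun s : ℂ => f s⁻¹) 0

/-!
Write `P = {x | ∀ i, ⟪a i, x⟫ ≤ b i}`. Moving `p₀` to the origin and rescaling by `r` gives
`V(r) = rⁿ * W(1 / r)`, where `W(s)` is the volume of the part of `{y | ∀ i, ⟪a i, y⟫ ≤ s * d i}`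
inside the unit ball, for some thresholds `d i` (`truncatedVolume_eq_pow_mul_wedgeVolume`). It
therefore suffices to show that `W` agrees on some interval `(0, ε)` with a function holomorphic near
the origin. The value at `s = 0` itself is irrelevant, and may differ.

If all `d i` vanish, `W` is constant. The thresholds are made nonzero one at a time. If `a j = 0`,
the `j`-th inequality holds everywhere or nowhere, according to the sign of `d j`. Otherwise,
moving the `j`-th threshold from `0` to `s * d j` changes the volume by an integral over slices
orthogonal to `a j` (`exists_wedgeVolume_eq_add_integral`). With `τ = v * d j / ‖a j‖` and
`ρ = √(1 - (s * τ)²)`, this is `s * (d j / ‖a j‖)` times the integral over `v ∈ [0, 1]` of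
`ρⁿ⁻¹ * W'(s / ρ)`, where `W'` is the analogous function of the slice, in dimension `n - 1`, whose
thresholds depend affinely on `v`. As `ρ` is holomorphic in `s` near the origin, induction on the
dimension shows that the integrand is holomorphic in `s`.

The combinatorial type of the slice may jump as `v` varies, so the holomorphic extension of `W'`
need not be continuous in `v`. To integrate it one only needs that it is measurable in the thresholds and
that its disc and its bound are uniform for bounded thresholds; this is what is carried through the
induction (`HasUniformHolomorphicExtension`).
-/

/-! ### Slicing and holomorphic integrals -/

/-- An orthogonal splitting of Euclidean space into the line spanned by `a` and its orthogonal
complement, as a volume preserving map. -/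
theorem exists_measurePreserving_split {n : ℕ} {a : EuclideanSpace ℝ (Fin (n + 1))}
    (ha : a ≠ 0) :
    ∃ Φ : EuclideanSpace ℝ (Fin (n + 1)) ≃ᵐ ℝ × EuclideanSpace ℝ (Fin n),
      MeasurePreserving Φ ∧ Φ a = (‖a‖, 0) ∧
      ∀ x y, inner ℝ x y = (Φ x).1 * (Φ y).1 + inner ℝ (Φ x).2 (Φ y).2 := by
  let e : Unit ⊕ Fin n → EuclideanSpace ℝ (Fin (n + 1)) := fun _ => ‖a‖⁻¹ • a
  have he : Orthonormal ℝ (({Sum.inl ()} : Set (Unit ⊕ Fin n)).domRestrict e) := by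
    refine ⟨fun i => ?_, fun i j hij => (hij (Subsingleton.elim _ _)).elim⟩
    simp [e, norm_smul, ha]
  obtain ⟨b, hb⟩ := he.exists_orthonormalBasis_extension_of_card_eq
    (by simp [add_comm])
  let b' := (OrthonormalBasis.singleton Unit ℝ).prod (EuclideanSpace.basisFun (Fin n) ℝ)
  let U := b.equiv b' (Equiv.refl _)
  have hU : MeasurePreserving U := U.measurePreserving
  have hW := WithLp.volume_preserving_symm_measurableEquiv_toLp_prod ℝ (EuclideanSpace ℝ (Fin n))
  refine ⟨U.toMeasurableEquiv.trans (MeasurableEquiv.toLp 2 _).symm, hW.comp hU, ?_, ?_⟩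
  · have h1 : U (‖a‖⁻¹ • a) = b' (Sum.inl ()) := by
      have := hb (Sum.inl ()) rfl
      simp only [e] at this
      rw [← this]
      simp [U, OrthonormalBasis.equiv_apply_basis]
    have h2 : U a = ‖a‖ • b' (Sum.inl ()) := by
      rw [← h1, map_smul, smul_smul, mul_inv_cancel₀ (norm_ne_zero_iff.2 ha), one_smul]
    change (U a).ofLp = _
    rw [h2]
    simp [b']
  · intro x y
    rw [← U.inner_map_map x y, WithLp.prod_inner_apply]
    simp [mul_comm]

/-- Fubini's theorem for the part of `C` between the hyperplanes `t = 0` and `t = T`. Both sides are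
signed, so `T` may be negative; the substitution `t = T * v` makes the domain of integration
independent of `T`. -/
theorem measureReal_inter_fst_le_sub {X : Type*} [MeasurableSpace X] {ν : Measure X} [SFinite ν]
    {C : Set (ℝ × X)} (hC : MeasurableSet C) (hfin : (volume.prod ν) C ≠ ⊤) (T : ℝ) :
    (volume.prod ν).real (C ∩ {p | p.1 ≤ T}) - (volume.prod ν).real (C ∩ {p | p.1 ≤ 0}) =
      T * ∫ v in (0 : ℝ)..1, ν.real (Prod.mk (T * v) ⁻¹' C) := by
  have hint : Integrable (fun t : ℝ => ν.real (Prod.mk t ⁻¹' C)) :=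
    Measure.integrable_measure_prodMk_left hC hfin
  have key : ∀ T : ℝ, (volume.prod ν).real (C ∩ {p | p.1 ≤ T}) =
      ∫ t in Set.Iic T, ν.real (Prod.mk t ⁻¹' C) := by
    intro T
    have hm : MeasurableSet {p : ℝ × X | p.1 ≤ T} := measurableSet_le measurable_fst measurable_const
    rw [measureReal_def, Measure.prod_apply (hC.inter hm), ← integral_indicator measurableSet_Iic,
      ← integral_toReal]
    · congr 1
      ext t
      by_cases h : t ≤ T
      · rw [Set.indicator_of_mem (by simpa using h), measureReal_def]
        congr 2
        ext x
        simp [h]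
      · rw [Set.indicator_of_notMem (by simpa using h)]
        simp [h]
    · exact (measurable_measure_prodMk_left (hC.inter hm)).aemeasurable
    · refine Measure.ae_measure_lt_top (hC.inter hm) ?_
      exact measure_ne_top_of_subset Set.inter_subset_left hfin
  rw [key, key, intervalIntegral.integral_Iic_sub_Iic hint.integrableOn hint.integrableOn]
  have := intervalIntegral.smul_integral_comp_mul_left (a := 0) (b := 1)
    (fun t : ℝ => ν.real (Prod.mk t ⁻¹' C)) T
  simpa using this.symm

/-- A bounded holomorphic family may be integrated in its parameter: Cauchy's estimate turns the
bound on the functions into the bound on their derivatives needed for dominated convergence. -/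
theorem differentiableOn_integral_of_bounded {α : Type*} [MeasurableSpace α] {μ : Measure α}
    [IsFiniteMeasure μ] {F : ℂ → α → ℂ} {U : Set ℂ} (hU : IsOpen U) {M : ℝ}
    (hmeas : ∀ z, AEStronglyMeasurable (F z) μ)
    (hF : ∀ᵐ v ∂μ, DifferentiableOn ℂ (fun z => F z v) U)
    (hM : ∀ᵐ v ∂μ, ∀ z ∈ U, ‖F z v‖ ≤ M) :
    DifferentiableOn ℂ (fun z => ∫ v, F z v ∂μ) U := by
  intro z₀ hz₀
  obtain ⟨δ, hδ, hball⟩ := Metric.isOpen_iff.1 hU z₀ hz₀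
  have hd : ∀ᵐ v ∂μ, ∀ z ∈ U, HasDerivAt (fun z => F z v) (deriv (fun z => F z v) z) z := by
    filter_upwards [hF] with v hv z hz
    exact (hv.differentiableAt (hU.mem_nhds hz)).hasDerivAt
  have hbound : ∀ᵐ v ∂μ, ∀ z ∈ Metric.ball z₀ (δ / 2),
      ‖deriv (fun z => F z v) z‖ ≤ M / (δ / 4) := by
    filter_upwards [hF, hM] with v hFv hMv z hz
    have hsub : Metric.closedBall z (δ / 4) ⊆ U := by
      refine fun w hw => hball ?_
      rw [Metric.mem_ball] at hz ⊢
      rw [Metric.mem_closedBall] at hw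
      linarith [dist_triangle w z z₀]
    refine Complex.norm_deriv_le_of_forall_mem_sphere_norm_le (by positivity) ?_ ?_
    · exact (hFv.mono (by
        rw [closure_ball _ (by positivity)]; exact hsub)).diffContOnCl
    · exact fun w hw => hMv w (hsub (Metric.sphere_subset_closedBall hw))
  -- The derivative is a pointwise limit of difference quotients, hence measurable.
  have hderiv_meas : AEStronglyMeasurable (fun v => deriv (fun z => F z v) z₀) μ := by
    obtain ⟨u, hu⟩ := (nhdsWithin (0 : ℂ) {0}ᶜ).exists_seq_tendsto
    refine aestronglyMeasurable_of_tendsto_ae (u := Filter.atTop)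
      (f := fun (k : ℕ) v => (u k)⁻¹ • (F (z₀ + u k) v - F z₀ v))
      (fun k => ((hmeas (z₀ + u k)).sub (hmeas z₀)).const_smul (u k)⁻¹) ?_
    filter_upwards [hd] with v hv
    exact (hv z₀ hz₀).tendsto_slope_zero.comp hu
  refine (hasDerivAt_integral_of_dominated_loc_of_deriv_le (μ := μ) (F := F)
    (F' := fun z v => deriv (fun z => F z v) z) (x₀ := z₀) (bound := fun _ => M / (δ / 4))
    (Metric.ball_mem_nhds z₀ (half_pos hδ)) (Filter.Eventually.of_forall hmeas)
    (Integrable.of_bound (hmeas z₀) M (by filter_upwards [hM] with v hv using hv z₀ hz₀))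
    hderiv_meas hbound (integrable_const _) ?_).2.differentiableAt.differentiableWithinAt
  filter_upwards [hd] with v hv z hz
  exact hv z (hball (Metric.ball_subset_ball (by linarith) hz))

/-! ### Volumes of polyhedral sets in the unit ball -/

/-- The volume of the part of the polyhedral set `{y | ∀ i, ⟪a i, y⟫ ≤ s * b i}` inside the unit
ball. The normals `a i` may vanish. -/
noncomputable def wedgeVolume {ι : Type*} {n : ℕ} (a : ι → EuclideanSpace ℝ (Fin n)) (b : ι → ℝ)
    (s : ℝ) : ℝ :=
  volume.real {y : EuclideanSpace ℝ (Fin n) | ‖y‖ ≤ 1 ∧ ∀ i, inner ℝ (a i) y ≤ s * b i}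

open scoped Pointwise in
theorem measureReal_norm_le_inter_eq_pow_mul_wedgeVolume {ι : Type*} {n : ℕ}
    (a : ι → EuclideanSpace ℝ (Fin n)) (b : ι → ℝ) (s : ℝ) {ρ : ℝ} (hρ : 0 < ρ) :
    volume.real {z : EuclideanSpace ℝ (Fin n) | ‖z‖ ≤ ρ ∧ ∀ i, inner ℝ (a i) z ≤ s * b i} =
      ρ ^ n * wedgeVolume a b (s / ρ) := by
  have : {z : EuclideanSpace ℝ (Fin n) | ‖z‖ ≤ ρ ∧ ∀ i, inner ℝ (a i) z ≤ s * b i} =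
      ρ • {y : EuclideanSpace ℝ (Fin n) | ‖y‖ ≤ 1 ∧ ∀ i, inner ℝ (a i) y ≤ s / ρ * b i} := by
    ext z
    rw [Set.mem_smul_set_iff_inv_smul_mem₀ hρ.ne']
    simp only [Set.mem_ofPred_eq, norm_smul, norm_inv, Real.norm_of_nonneg hρ.le, inner_smul_right]
    refine and_congr ?_ (forall_congr' fun i => ?_)
    · rw [inv_mul_le_iff₀ hρ, mul_one]
    · rw [inv_mul_le_iff₀ hρ]
      field_simp
  rw [this, measureReal_def, Measure.addHaar_smul_of_nonneg _ hρ.le, ENNReal.toReal_mul,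
    finrank_euclideanSpace_fin, ENNReal.toReal_ofReal (by positivity)]
  rfl

theorem wedgeVolume_of_eq_zero {ι : Type*} [DecidableEq ι] {n : ℕ}
    {a : ι → EuclideanSpace ℝ (Fin n)} {j : ι} (hj : a j = 0) (b : ι → ℝ) {s : ℝ} (hs : 0 < s) :
    wedgeVolume a b s = if 0 ≤ b j then wedgeVolume a (Function.update b j 0) s else 0 := by
  split_ifs with hb
  · unfold wedgeVolume
    congr 1
    ext y
    refine and_congr_right fun _ => forall_congr' fun i => ?_
    rcases eq_or_ne i j with rfl | hij
    · simp [hj, mul_nonneg hs.le hb]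
    · simp [hij]
  · unfold wedgeVolume
    rw [Set.eq_empty_of_forall_notMem (s := {y | _ ∧ _})]
    · simp
    · rintro y ⟨-, hy⟩
      have := hy j
      rw [hj, inner_zero_left] at this
      exact hb (nonneg_of_mul_nonneg_right this hs)

/-- The slicing formula. Moving the `j`-th facet from the origin to its position sweeps out
slices orthogonal to `a j`. The slice at height `t = s * (b j / ‖a j‖ * v)` is a set of the same
kind, in a ball of radius `√(1 - t²)` in one dimension less, hence rescales to a `wedgeVolume`. The
thresholds of the slice are again proportional to `s`. Its `j`-th inequality has been used up, so
`a' j` is zero and the `j`-th threshold is set to zero, which makes the inequality trivial. -/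
theorem exists_wedgeVolume_eq_add_integral {ι : Type*} [Finite ι] [DecidableEq ι] {n : ℕ}
    (a : ι → EuclideanSpace ℝ (Fin (n + 1))) {j : ι} (hj : a j ≠ 0) :
    ∃ (a' : ι → EuclideanSpace ℝ (Fin n)) (α : ι → ℝ), ∀ (b : ι → ℝ) (s : ℝ),
      |s * (b j / ‖a j‖)| < 1 →
      wedgeVolume a b s = wedgeVolume a (Function.update b j 0) s +
        s * (b j / ‖a j‖) * ∫ v in (0 : ℝ)..1, √(1 - (s * (b j / ‖a j‖ * v)) ^ 2) ^ n *
          wedgeVolume a' (Function.update (fun i => b i - b j / ‖a j‖ * v * α i) j 0)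
            (s / √(1 - (s * (b j / ‖a j‖ * v)) ^ 2)) := by
  obtain ⟨Φ, hΦ, hΦj, hinner⟩ := exists_measurePreserving_split hj
  have hpos : 0 < ‖a j‖ := norm_pos_iff.2 hj
  refine ⟨fun i => (Φ (a i)).2, fun i => (Φ (a i)).1, fun b s hT => ?_⟩
  set β := b j / ‖a j‖ with hβ
  -- `C` is the polyhedral set in the unit ball without its `j`-th inequality, in split coordinates.
  let C : Set (ℝ × EuclideanSpace ℝ (Fin n)) := {p | p.1 ^ 2 + ‖p.2‖ ^ 2 ≤ 1 ∧
    ∀ i, i ≠ j → (Φ (a i)).1 * p.1 + inner ℝ (Φ (a i)).2 p.2 ≤ s * b i}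
  have hC : MeasurableSet C := by
    simp only [C, Set.ofPred_and, Set.ofPred_forall]
    have h (i : ι) : Measurable fun p : ℝ × EuclideanSpace ℝ (Fin n) =>
        (Φ (a i)).1 * p.1 + inner ℝ (Φ (a i)).2 p.2 := by fun_prop
    exact (measurableSet_le (by fun_prop) measurable_const).inter <|
      MeasurableSet.iInter fun i => MeasurableSet.iInter fun _ =>
        measurableSet_le (h i) measurable_const
  have hnorm : ∀ y, ‖y‖ ≤ 1 ↔ (Φ y).1 ^ 2 + ‖(Φ y).2‖ ^ 2 ≤ 1 := by
    intro y
    rw [← real_inner_self_eq_norm_sq, sq, ← hinner, real_inner_self_eq_norm_sq,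
      sq_le_one_iff₀ (norm_nonneg _)]
  have hset : ∀ b' : ι → ℝ, (∀ i, i ≠ j → b' i = b i) →
      {y | ‖y‖ ≤ 1 ∧ ∀ i, inner ℝ (a i) y ≤ s * b' i} =
        Φ ⁻¹' (C ∩ {p | p.1 ≤ s * (b' j / ‖a j‖)}) := by
    intro b' hb'
    ext y
    have h1 : (inner ℝ (a j) y ≤ s * b' j) ↔ (Φ y).1 ≤ s * (b' j / ‖a j‖) := by
      rw [hinner, hΦj, ← mul_div_assoc, le_div_iff₀ hpos]
      simp [mul_comm]
    constructor
    · rintro ⟨hy, h⟩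
      exact ⟨⟨(hnorm y).1 hy, fun i hi => by rw [← hinner, ← hb' i hi]; exact h i⟩, h1.1 (h j)⟩
    · rintro ⟨⟨hy, h⟩, h'⟩
      refine ⟨(hnorm y).2 hy, fun i => ?_⟩
      rcases eq_or_ne i j with rfl | hi
      · exact h1.2 h'
      · rw [hinner, hb' i hi]; exact h i hi
  have hmeas : ∀ t : ℝ, MeasurableSet (C ∩ {p | p.1 ≤ t}) := fun t =>
    hC.inter (measurableSet_le measurable_fst measurable_const)
  have hfin : (volume.prod volume) C ≠ ⊤ := by
    have h := hΦ.measure_preimage hC.nullMeasurableSet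
    rw [Measure.volume_eq_prod] at h
    rw [← h]
    refine measure_ne_top_of_subset (s := Metric.closedBall (0 : EuclideanSpace ℝ (Fin (n + 1))) 1)
      (fun y hy => ?_)
      measure_closedBall_lt_top.ne
    simpa using (hnorm y).2 hy.1
  have hvol : ∀ b' : ι → ℝ, (∀ i, i ≠ j → b' i = b i) →
      wedgeVolume a b' s = (volume.prod volume).real (C ∩ {p | p.1 ≤ s * (b' j / ‖a j‖)}) := by
    intro b' hb'
    rw [wedgeVolume, hset b' hb', measureReal_def, hΦ.measure_preimage (hmeas _).nullMeasurableSet]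
    rfl
  have h0 := hvol (Function.update b j 0) (fun i hi => by simp [hi])
  rw [Function.update_self, zero_div, mul_zero] at h0
  rw [h0, hvol b (fun _ _ => rfl), ← sub_eq_iff_eq_add',
    measureReal_inter_fst_le_sub hC hfin]
  congr 1
  refine intervalIntegral.integral_congr fun v hv => ?_
  rw [Set.uIcc_of_le zero_le_one] at hv
  have ht : (s * (β * v)) ^ 2 < 1 := by
    rw [sq_lt_one_iff_abs_lt_one, ← mul_assoc, abs_mul, abs_of_nonneg hv.1]
    exact (mul_le_of_le_one_right (abs_nonneg _) hv.2).trans_lt hT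
  have hρ : 0 < √(1 - (s * (β * v)) ^ 2) := Real.sqrt_pos.2 (by linarith)
  dsimp only
  rw [← measureReal_norm_le_inter_eq_pow_mul_wedgeVolume _ _ _ hρ]
  congr 1
  ext z
  refine and_congr ?_ ⟨fun h i => ?_, fun h i hi => ?_⟩
  · dsimp only
    rw [Real.le_sqrt (norm_nonneg _) (by linarith), mul_assoc]
    constructor <;> intro h <;> linarith
  · rcases eq_or_ne i j with rfl | hi
    · simp [hΦj]
    · have := h i hi
      dsimp only at this
      rw [Function.update_of_ne hi]
      linarith
  · have := h i
    rw [Function.update_of_ne hi] at this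
    dsimp only
    linarith

/-! ### Holomorphic extension in the scaling parameter -/

/-- The branch of `√(1 - w²)` on the unit disc with value `1` at the origin. -/
noncomputable def sqrtOneSubSq (w : ℂ) : ℂ := (1 - w ^ 2) ^ (1 / 2 : ℂ)

theorem measurable_sqrtOneSubSq : Measurable sqrtOneSubSq := by
  unfold sqrtOneSubSq
  fun_prop

theorem sqrtOneSubSq_sq (w : ℂ) : sqrtOneSubSq w ^ 2 = 1 - w ^ 2 := by
  have := Complex.cpow_nat_inv_pow (1 - w ^ 2) two_ne_zero
  simpa only [sqrtOneSubSq, one_div, Nat.cast_ofNat] using this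

theorem sqrtOneSubSq_ofReal {t : ℝ} (ht : |t| ≤ 1) :
    sqrtOneSubSq t = (√(1 - t ^ 2) : ℝ) := by
  have : 0 ≤ 1 - t ^ 2 := by linarith [(sq_le_one_iff_abs_le_one t).2 ht]
  rw [Real.sqrt_eq_rpow, Complex.ofReal_cpow this]
  simp [sqrtOneSubSq]

theorem half_le_norm_sqrtOneSubSq {w : ℂ} (hw : ‖w‖ ≤ 1 / 2) : 1 / 2 ≤ ‖sqrtOneSubSq w‖ := by
  have h : 1 - ‖w‖ ^ 2 ≤ ‖sqrtOneSubSq w‖ ^ 2 := by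
    have := norm_sub_norm_le (1 : ℂ) (w ^ 2)
    rwa [norm_one, ← sqrtOneSubSq_sq, norm_pow, norm_pow] at this
  nlinarith [norm_nonneg w, norm_nonneg (sqrtOneSubSq w)]

theorem norm_sqrtOneSubSq_le_two {w : ℂ} (hw : ‖w‖ ≤ 1 / 2) : ‖sqrtOneSubSq w‖ ≤ 2 := by
  have h : ‖sqrtOneSubSq w‖ ^ 2 ≤ 1 + ‖w‖ ^ 2 := by
    have := norm_sub_le (1 : ℂ) (w ^ 2)
    rwa [norm_one, ← sqrtOneSubSq_sq, norm_pow, norm_pow] at this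
  nlinarith [norm_nonneg w, norm_nonneg (sqrtOneSubSq w)]

theorem differentiableAt_sqrtOneSubSq {w : ℂ} (hw : ‖w‖ ≤ 1 / 2) :
    DifferentiableAt ℂ sqrtOneSubSq w := by
  refine DifferentiableAt.cpow (by fun_prop) (differentiableAt_const _) ?_
  refine Or.inl ?_
  have h : (w ^ 2).re ≤ ‖w‖ ^ 2 := (Complex.re_le_norm _).trans_eq (norm_pow w 2)
  rw [Complex.sub_re, Complex.one_re]
  nlinarith [norm_nonneg w]

/-- For every parameter `b ∈ D` the function `w b` agrees on a right neighborhood `(0, ε)` of `0`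
with a function holomorphic on the disc of radius `ε`. The radius and a bound for the
holomorphic function are uniform in `b`, and it is jointly measurable in `b` and its argument. -/
def HasUniformHolomorphicExtension {β : Type*} [MeasurableSpace β] (w : β → ℝ → ℝ)
    (D : Set β) : Prop :=
  ∃ ε > 0, ∃ (M : ℝ) (f : β × ℂ → ℂ), Measurable f ∧ ∀ b ∈ D,
    DifferentiableOn ℂ (fun z => f (b, z)) (Metric.ball 0 ε) ∧
    (∀ z ∈ Metric.ball (0 : ℂ) ε, ‖f (b, z)‖ ≤ M) ∧
    ∀ s : ℝ, 0 < s → s < ε → f (b, (s : ℂ)) = (w b s : ℝ)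

/-- The thresholds bounded by `K` and supported in `S`. -/
def boundedSupportedIn {ι : Type*} (K : ℝ) (S : Finset ι) : Set (ι → ℝ) :=
  {b | ∀ i, |b i| ≤ K ∧ (i ∉ S → b i = 0)}

theorem update_mem_boundedSupportedIn {ι : Type*} [DecidableEq ι] {K : ℝ} {S : Finset ι} {j : ι}
    {b : ι → ℝ} (hK : 0 ≤ K) (hb : b ∈ boundedSupportedIn K (insert j S)) :
    Function.update b j 0 ∈ boundedSupportedIn K S := by
  intro i
  rcases eq_or_ne i j with rfl | hi
  · simpa using hK
  · have := hb i
    simpa [hi] using this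

theorem measurable_update_zero {ι : Type*} [DecidableEq ι] (j : ι) :
    Measurable fun b : ι → ℝ => Function.update b j 0 := by
  fun_prop

/-- The induction step of `hasUniformHolomorphicExtension_wedgeVolume` when the new normal
vanishes, so that the new inequality holds everywhere or nowhere. -/
theorem HasUniformHolomorphicExtension.insert_of_eq_zero {ι : Type*} [Fintype ι] [DecidableEq ι]
    {n : ℕ} {a : ι → EuclideanSpace ℝ (Fin n)} {j : ι} (hj : a j = 0) {S : Finset ι} {K : ℝ}
    (hK : 0 ≤ K) (h : HasUniformHolomorphicExtension (wedgeVolume a) (boundedSupportedIn K S)) :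
    HasUniformHolomorphicExtension (wedgeVolume a) (boundedSupportedIn K (insert j S)) := by
  obtain ⟨ε, hε, M, f, hf, hD⟩ := h
  refine ⟨ε, hε, M, fun p => if 0 ≤ p.1 j then f (Function.update p.1 j 0, p.2) else 0, ?_, ?_⟩
  · refine Measurable.ite (measurableSet_le measurable_const (by fun_prop)) ?_ measurable_const
    exact hf.comp (((measurable_update_zero j).comp measurable_fst).prodMk measurable_snd)
  · intro b hb
    obtain ⟨h1, h2, h3⟩ := hD _ (update_mem_boundedSupportedIn hK hb)
    have hM : 0 ≤ M := (norm_nonneg _).trans (h2 0 (Metric.mem_ball_self hε))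
    refine ⟨?_, ?_, fun s hs hs' => ?_⟩
    · by_cases hbj : 0 ≤ b j
      · simpa [hbj] using h1
      · simp [hbj]
    · by_cases hbj : 0 ≤ b j
      · simpa [hbj] using h2
      · simp [hbj, hM]
    · rw [wedgeVolume_of_eq_zero hj b hs]
      by_cases hbj : 0 ≤ b j
      · simpa [hbj] using h3 s hs hs'
      · simp [hbj]

/-- The induction step of `hasUniformHolomorphicExtension_wedgeVolume` when the new normal is
nonzero: the slicing formula for real `s` is used to define the extension for complex `s`. -/
theorem HasUniformHolomorphicExtension.insert_of_ne_zero {ι : Type*} [Fintype ι] [DecidableEq ι]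
    {n : ℕ} {a : ι → EuclideanSpace ℝ (Fin (n + 1))} {j : ι} (hj : a j ≠ 0) {S : Finset ι} {K : ℝ}
    (hK : 0 ≤ K)
    (hsec : ∀ (a' : ι → EuclideanSpace ℝ (Fin n)) (K' : ℝ), 0 ≤ K' →
      HasUniformHolomorphicExtension (wedgeVolume a') (boundedSupportedIn K' Finset.univ))
    (h : HasUniformHolomorphicExtension (wedgeVolume a) (boundedSupportedIn K S)) :
    HasUniformHolomorphicExtension (wedgeVolume a) (boundedSupportedIn K (insert j S)) := by
  obtain ⟨a', α, hrec⟩ := exists_wedgeVolume_eq_add_integral a hj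
  have hpos : 0 < ‖a j‖ := norm_pos_iff.2 hj
  set B := K / ‖a j‖ with hB
  have hB0 : 0 ≤ B := by positivity
  obtain ⟨ε₁, hε₁, M₁, f₁, hf₁, hD₁⟩ := h
  obtain ⟨ε₂, hε₂, M₂, f₂, hf₂, hD₂⟩ := hsec a' (K + B * ∑ i, |α i|) (by positivity)
  let c : (ι → ℝ) → ℝ → ι → ℝ := fun b v =>
    Function.update (fun i => b i - b j / ‖a j‖ * v * α i) j 0
  have hc_meas : Measurable fun q : (ι → ℝ) × ℝ => c q.1 q.2 := by
    refine (measurable_update_zero j).comp (measurable_pi_lambda _ fun i => ?_)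
    fun_prop
  have hτ : ∀ b ∈ boundedSupportedIn K (insert j S), ∀ v ∈ Set.Ioc (0 : ℝ) 1,
      |b j / ‖a j‖ * v| ≤ B := by
    intro b hb v hv
    rw [abs_mul, abs_div, abs_of_pos hpos, abs_of_pos hv.1]
    refine (mul_le_of_le_one_right (by positivity) hv.2).trans ?_
    exact div_le_div_of_nonneg_right (hb j).1 hpos.le
  have hc_mem : ∀ b ∈ boundedSupportedIn K (insert j S), ∀ v ∈ Set.Ioc (0 : ℝ) 1,
      c b v ∈ boundedSupportedIn (K + B * ∑ i, |α i|) Finset.univ := by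
    intro b hb v hv i
    refine ⟨?_, fun h => (h (Finset.mem_univ i)).elim⟩
    rcases eq_or_ne i j with rfl | hi
    · simpa [c] using (by positivity : 0 ≤ K + B * ∑ i, |α i|)
    · simp only [c, Function.update_of_ne hi]
      calc |b i - b j / ‖a j‖ * v * α i| ≤ |b i| + |b j / ‖a j‖ * v| * |α i| := by
            rw [← abs_mul]; exact abs_sub _ _
        _ ≤ K + B * ∑ i, |α i| := by
            gcongr
            · exact (hb i).1
            · exact hτ b hb v hv
            · exact Finset.single_le_sum (f := fun i => |α i|) (fun _ _ => abs_nonneg _)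
                (Finset.mem_univ i)
  -- The integrand of the slicing formula, with the real variable `s` replaced by the complex `z`.
  let g : (ι → ℝ) → ℂ → ℝ → ℂ := fun b z v =>
    sqrtOneSubSq (z * (b j / ‖a j‖ * v : ℝ)) ^ n *
      f₂ (c b v, z / sqrtOneSubSq (z * (b j / ‖a j‖ * v : ℝ)))
  have hg_meas : Measurable fun q : ((ι → ℝ) × ℂ) × ℝ => g q.1.1 q.1.2 q.2 := by
    have hw : Measurable fun q : ((ι → ℝ) × ℂ) × ℝ =>
        sqrtOneSubSq (q.1.2 * (q.1.1 j / ‖a j‖ * q.2 : ℝ)) := by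
      refine measurable_sqrtOneSubSq.comp ?_
      fun_prop
    refine (hw.pow_const n).mul (hf₂.comp (Measurable.prodMk ?_ ?_))
    · exact hc_meas.comp ((measurable_fst.comp measurable_fst).prodMk measurable_snd)
    · exact (measurable_snd.comp measurable_fst).div hw
  -- `ε₂ / 2` keeps `z / √(1 - (zτ)²)` in the disc of `f₂`, the square root being at least `1 / 2` in
  -- absolute value; the last bound keeps `zτ` in the disc of radius `1 / 2`.
  set ε := min ε₁ (min (ε₂ / 2) (1 / (2 * (B + 1)))) with hε
  have hε0 : 0 < ε := by positivity
  have hsmall : ∀ z ∈ Metric.ball (0 : ℂ) ε, ∀ τ : ℝ, |τ| ≤ B → ‖z * τ‖ ≤ 1 / 2 := by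
    intro z hz τ hτB
    have hz' : ‖z‖ < 1 / (2 * (B + 1)) := (mem_ball_zero_iff.1 hz).trans_le
      ((min_le_right _ _).trans (min_le_right _ _))
    rw [norm_mul, Complex.norm_real, Real.norm_eq_abs]
    calc ‖z‖ * |τ| ≤ 1 / (2 * (B + 1)) * B := by gcongr
      _ ≤ 1 / (2 * (B + 1)) * (B + 1) := by gcongr; linarith
      _ = 1 / 2 := by field_simp
  have hdiv : ∀ z ∈ Metric.ball (0 : ℂ) ε, ∀ τ : ℝ, |τ| ≤ B →
      z / sqrtOneSubSq (z * τ) ∈ Metric.ball 0 ε₂ := by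
    intro z hz τ hτB
    have hz' : ‖z‖ < ε₂ / 2 := (mem_ball_zero_iff.1 hz).trans_le
      ((min_le_right _ _).trans (min_le_left _ _))
    have hρ := half_le_norm_sqrtOneSubSq (hsmall z hz τ hτB)
    rw [mem_ball_zero_iff, norm_div, div_lt_iff₀ (by linarith)]
    nlinarith
  have hg_diff : ∀ b ∈ boundedSupportedIn K (insert j S), ∀ v ∈ Set.Ioc (0 : ℝ) 1,
      DifferentiableOn ℂ (fun z => g b z v) (Metric.ball 0 ε) := by
    intro b hb v hv z hz
    have hρ := half_le_norm_sqrtOneSubSq (hsmall z hz _ (hτ b hb v hv))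
    have hρd : DifferentiableAt ℂ (fun z => sqrtOneSubSq (z * (b j / ‖a j‖ * v : ℝ))) z :=
      DifferentiableAt.fun_comp' z (differentiableAt_sqrtOneSubSq (hsmall z hz _ (hτ b hb v hv)))
        (by fun_prop)
    refine DifferentiableAt.differentiableWithinAt ((hρd.pow n).mul ?_)
    have hf := (hD₂ _ (hc_mem b hb v hv)).1.differentiableAt
      (Metric.isOpen_ball.mem_nhds (hdiv z hz _ (hτ b hb v hv)))
    have hne : sqrtOneSubSq (z * (b j / ‖a j‖ * v : ℝ)) ≠ 0 := norm_pos_iff.1 (by linarith)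
    exact DifferentiableAt.fun_comp' (g := fun z => f₂ (c b v, z)) z hf
      (differentiableAt_id.fun_div hρd hne)
  have hg_bound : ∀ b ∈ boundedSupportedIn K (insert j S), ∀ v ∈ Set.Ioc (0 : ℝ) 1,
      ∀ z ∈ Metric.ball (0 : ℂ) ε, ‖g b z v‖ ≤ 2 ^ n * M₂ := by
    intro b hb v hv z hz
    rw [norm_mul, norm_pow]
    gcongr
    · exact norm_sqrtOneSubSq_le_two (hsmall z hz _ (hτ b hb v hv))
    · exact (hD₂ _ (hc_mem b hb v hv)).2.1 _ (hdiv z hz _ (hτ b hb v hv))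
  refine ⟨ε, hε0, M₁ + ε * B * (2 ^ n * M₂), fun p => f₁ (Function.update p.1 j 0, p.2) +
    p.2 * (p.1 j / ‖a j‖ : ℝ) * ∫ v in Set.Ioc (0 : ℝ) 1, g p.1 p.2 v, ?_, fun b hb => ?_⟩
  · refine Measurable.add ?_ (Measurable.mul (by fun_prop) ?_)
    · exact hf₁.comp (((measurable_update_zero j).comp measurable_fst).prodMk measurable_snd)
    · exact hg_meas.stronglyMeasurable.integral_prod_right'.measurable
  · obtain ⟨h1, h2, h3⟩ := hD₁ _ (update_mem_boundedSupportedIn hK hb)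
    have hsub : Metric.ball (0 : ℂ) ε ⊆ Metric.ball 0 ε₁ :=
      Metric.ball_subset_ball (min_le_left _ _)
    refine ⟨?_, fun z hz => ?_, fun s hs hs' => ?_⟩
    · refine (h1.mono hsub).add (DifferentiableOn.fun_mul
        (differentiableOn_id.mul_const ((b j / ‖a j‖ : ℝ) : ℂ)) ?_)
      refine differentiableOn_integral_of_bounded (M := 2 ^ n * M₂) Metric.isOpen_ball
        (fun z => ?_) ?_ ?_
      · exact (hg_meas.comp (measurable_const.prodMk measurable_id :
          Measurable fun v : ℝ => ((b, z), v))).aestronglyMeasurable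
      · exact ae_restrict_of_forall_mem measurableSet_Ioc (hg_diff b hb)
      · exact ae_restrict_of_forall_mem measurableSet_Ioc (hg_bound b hb)
    · have hI : ‖∫ v in Set.Ioc (0 : ℝ) 1, g b z v‖ ≤ 2 ^ n * M₂ := by
        simpa using norm_setIntegral_le_of_norm_le_const (μ := volume) (by simp)
          (fun v hv => hg_bound b hb v hv z hz)
      have hbj : |b j / ‖a j‖| ≤ B := by simpa using hτ b hb 1 (by simp)
      refine (norm_add_le _ _).trans (add_le_add (h2 z (hsub hz)) ?_)
      rw [norm_mul, norm_mul, Complex.norm_real, Real.norm_eq_abs]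
      have := (mem_ball_zero_iff.1 hz).le
      gcongr
    · have hs_mem : (s : ℂ) ∈ Metric.ball (0 : ℂ) ε := by
        simpa [abs_of_pos hs] using hs'
      have hbj : |b j / ‖a j‖| ≤ B := by simpa using hτ b hb 1 (by simp)
      have hsj := hsmall s hs_mem _ hbj
      rw [hrec b s (by
        rw [← Complex.ofReal_mul, Complex.norm_real, Real.norm_eq_abs] at hsj; linarith),
        intervalIntegral.integral_of_le zero_le_one]
      push_cast
      rw [h3 s hs (hs'.trans_le (min_le_left _ _)), ← integral_complex_ofReal]
      congr 2
      refine setIntegral_congr_fun measurableSet_Ioc fun v hv => ?_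
      have ht : |s * (b j / ‖a j‖ * v)| ≤ 1 / 2 := by
        have := hsmall s hs_mem _ (hτ b hb v hv)
        rwa [← Complex.ofReal_mul, Complex.norm_real, Real.norm_eq_abs] at this
      have hρ : sqrtOneSubSq (s * (b j / ‖a j‖ * v : ℝ)) =
          (√(1 - (s * (b j / ‖a j‖ * v)) ^ 2) : ℝ) := by
        rw [← Complex.ofReal_mul, sqrtOneSubSq_ofReal (by linarith)]
      have hρ0 : 0 < √(1 - (s * (b j / ‖a j‖ * v)) ^ 2) :=
        Real.sqrt_pos.2 (by nlinarith [abs_le.1 ht])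
      have hd := hdiv s hs_mem _ (hτ b hb v hv)
      rw [hρ, ← Complex.ofReal_div, mem_ball_zero_iff, Complex.norm_real, Real.norm_eq_abs,
        abs_of_pos (by positivity)] at hd
      simp only [g]
      rw [hρ, ← Complex.ofReal_div, (hD₂ _ (hc_mem b hb v hv)).2.2 _ (by positivity) hd]
      push_cast
      rfl

/-- If all thresholds vanish, the set is the intersection of the unit ball with a cone that does not
depend on `s`. -/
theorem hasUniformHolomorphicExtension_wedgeVolume_empty {ι : Type*} {n : ℕ}
    (a : ι → EuclideanSpace ℝ (Fin n)) (K : ℝ) :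
    HasUniformHolomorphicExtension (wedgeVolume a) (boundedSupportedIn K ∅) := by
  refine ⟨1, one_pos, _, fun _ => (wedgeVolume a 0 1 : ℝ), measurable_const, fun b hb =>
    ⟨by fun_prop, fun _ _ => le_rfl, fun s _ _ => ?_⟩⟩
  obtain rfl : b = 0 := funext fun i => (hb i).2 (Finset.notMem_empty i)
  simp [wedgeVolume]

/-- By induction on the dimension, and in each dimension on the set `S` of inequalities with a
possibly nonzero threshold. -/
theorem hasUniformHolomorphicExtension_wedgeVolume {ι : Type*} [Fintype ι] [DecidableEq ι]
    (n : ℕ) (a : ι → EuclideanSpace ℝ (Fin n)) (S : Finset ι) {K : ℝ} (hK : 0 ≤ K) :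
    HasUniformHolomorphicExtension (wedgeVolume a) (boundedSupportedIn K S) := by
  induction n generalizing S K with
  | zero =>
    induction S using Finset.induction_on with
    | empty => exact hasUniformHolomorphicExtension_wedgeVolume_empty a K
    -- In dimension zero every normal vanishes.
    | insert j S _ ih => exact ih.insert_of_eq_zero (Subsingleton.elim _ _) hK
  | succ n ihn =>
    induction S using Finset.induction_on with
    | empty => exact hasUniformHolomorphicExtension_wedgeVolume_empty a K
    | insert j S _ ih =>
      by_cases hj : a j = 0
      · exact ih.insert_of_eq_zero hj hK
      · exact ih.insert_of_ne_zero hj hK (fun a' K' hK' => ihn a' Finset.univ hK')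

/-! ### Volumes in large balls -/

/-- Translating `p₀` to the origin and rescaling the ball of radius `r` to the unit ball. -/
theorem truncatedVolume_eq_pow_mul_wedgeVolume {ι : Type*} {n : ℕ}
    (a : ι → EuclideanSpace ℝ (Fin n)) (b : ι → ℝ) (p₀ : EuclideanSpace ℝ (Fin n)) {r : ℝ}
    (hr : 0 < r) :
    truncatedVolume {x | ∀ i, inner ℝ (a i) x ≤ b i} p₀ r =
      r ^ n * wedgeVolume a (fun i => b i - inner ℝ (a i) p₀) r⁻¹ := by
  rw [truncatedVolume, if_neg hr.not_gt, ← one_div,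
    ← measureReal_norm_le_inter_eq_pow_mul_wedgeVolume _ _ _ hr, measureReal_def,
    ← measure_preimage_add_right volume p₀]
  congr 2
  ext z
  simp [inner_add_right, and_comm, le_sub_iff_add_le]

theorem IsPolyhedralSet.exists_eq_setOf_inner_le {n : ℕ} {P : Set (EuclideanSpace ℝ (Fin n))}
    (hP : IsPolyhedralSet P) :
    ∃ (ι : Type) (_ : Fintype ι) (a : ι → EuclideanSpace ℝ (Fin n)) (b : ι → ℝ),
      P = {x | ∀ i, inner ℝ (a i) x ≤ b i} := by
  obtain ⟨-, 𝓗, hfin, hH, rfl⟩ := hP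
  choose a b _ hab using hH
  refine ⟨𝓗, hfin.fintype, fun H => a H H.2, fun H => b H H.2, ?_⟩
  ext x
  simp only [Set.mem_sInter, Set.mem_ofPred_eq, Subtype.forall]
  refine forall₂_congr fun H hH => ?_
  conv_lhs => rw [hab H hH]
  rfl

theorem hasPoleAtInftyOfOrderLE_pow_mul {n : ℕ} {F : ℂ → ℂ} (hF : AnalyticAt ℂ F 0) :
    HasPoleAtInftyOfOrderLE (fun z => z ^ n * F z⁻¹) n := by
  have hid : MeromorphicAt (fun s : ℂ => s) 0 := MeromorphicAt.id 0
  have hpow : MeromorphicAt (fun s : ℂ => s ^ (-(n : ℤ))) 0 := hid.fun_zpow _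
  have heq : (fun s : ℂ => s⁻¹ ^ n * F s⁻¹⁻¹) = fun s => s ^ (-(n : ℤ)) * F s := by
    ext s
    simp
  unfold HasPoleAtInftyOfOrderLE
  rw [heq]
  refine ⟨hpow.fun_mul hF.meromorphicAt, ?_⟩
  have h1 : meromorphicOrderAt (fun s : ℂ => s) 0 = 1 := meromorphicOrderAt_id
  rw [fun_meromorphicOrderAt_mul hpow hF.meromorphicAt, fun_meromorphicOrderAt_zpow hid, h1,
    mul_one]
  exact le_add_of_nonneg_right hF.meromorphicOrderAt_nonneg

theorem mainTheorem7 (n : ℕ) (P : Set (EuclideanSpace ℝ (Fin n))) (hP : IsPolyhedralSet P)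
    (p₀ : EuclideanSpace ℝ (Fin n)) :
    ∃ (R : ℝ) (f : ℂ → ℂ), 0 < R ∧
      DifferentiableOn ℂ f {z : ℂ | R < ‖z‖} ∧
      (∀ r : ℝ, R < r → f (r : ℂ) = ((truncatedVolume P p₀ r : ℝ) : ℂ)) ∧
      HasPoleAtInftyOfOrderLE f n := by
  classical
  obtain ⟨ι, _, a, b, rfl⟩ := hP.exists_eq_setOf_inner_le
  set d : ι → ℝ := fun i => b i - inner ℝ (a i) p₀ with hd
  obtain ⟨ε, hε, M, F, -, hF⟩ := hasUniformHolomorphicExtension_wedgeVolume n a Finset.univ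
    (K := ∑ i, |d i|) (by positivity)
  obtain ⟨hdiff, -, heq⟩ := hF d fun i => ⟨Finset.single_le_sum (f := fun i => |d i|)
    (fun _ _ => abs_nonneg _) (Finset.mem_univ i), fun h => (h (Finset.mem_univ i)).elim⟩
  refine ⟨ε⁻¹, fun z => z ^ n * F (d, z⁻¹), inv_pos.2 hε, ?_, fun r hr => ?_,
    hasPoleAtInftyOfOrderLE_pow_mul (F := fun z => F (d, z))
      (hdiff.analyticAt (Metric.ball_mem_nhds 0 hε))⟩
  · have hne : ∀ z ∈ {z : ℂ | ε⁻¹ < ‖z‖}, z ≠ 0 := fun z hz =>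
      norm_pos_iff.1 ((inv_pos.2 hε).trans hz)
    refine (differentiableOn_id.pow n).mul
      (hdiff.comp (differentiableOn_id.inv hne) fun z hz => ?_)
    simpa using inv_lt_of_inv_lt₀ hε hz
  · have hr0 : 0 < r := (inv_pos.2 hε).trans hr
    rw [truncatedVolume_eq_pow_mul_wedgeVolume a b p₀ hr0]
    have := heq r⁻¹ (inv_pos.2 hr0) (inv_lt_of_inv_lt₀ hε hr)
    push_cast at this ⊢
    rw [this]
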